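/- A signed partition of an integer $n$ is a pair $(\pi,\nu)$ of ordinary partitions with $|\pi|-|\nu|=n$; the parts of $\pi$ are called its positive parts and the parts of $\nu$ its negative parts (so negative parts are recorded by their absolute values). For an integer $n\ge 0$, let $LG_2(n)$ denote the number of partitions of $n$ into parts $\ge 2$ in which any two parts differ by at least $2$, and any two odd parts differ by at least $4$. Let $H(n)$ be the set of signed partitions of $n$ whose positive parts are even and distinct, and whose negative parts are distinct, congruent to $3 \pmod 4$, and less than twice the number of positive parts. Then, for every integer $n\ge 0$, the set $H(n)$ is finite and $LG_2(n)=|H(n)|$. -/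

import Mathlib

/-- A signed partition of the integer `n`: a pair of ordinary partitions `(pos, neg)` with
`|pos| - |neg| = n`. The parts of `pos` are the positive parts, and the parts of `neg` (recorded by
their absolute values) are the negative parts. -/
structure SignedPartition (n : ℤ) where
  posSize : ℕ
  negSize : ℕ
  pos : posSize.Partition
  neg : negSize.Partition
  size_eq : (posSize : ℤ) - (negSize : ℤ) = n

/-- The second little Göllnitz partitions of `n`: all parts are at least `2`, any two parts differ
by at least `2` (in particular no part is repeated), and any two odd parts differ by at
least `4`. -/
def secondLittleGollnitz (n : ℕ) : Set n.Partition :=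
  {p | p.parts.Nodup ∧ (∀ x ∈ p.parts, 2 ≤ x) ∧
    (∀ x ∈ p.parts, ∀ y ∈ p.parts, y < x → y + 2 ≤ x) ∧
    (∀ x ∈ p.parts, ∀ y ∈ p.parts, Odd x → Odd y → y < x → y + 4 ≤ x)}

/-- The number of second little Göllnitz partitions of `n`. -/
noncomputable def LG₂ (n : ℕ) : ℕ := (secondLittleGollnitz n).ncard

/-- The signed partitions of `n` whose positive parts are even and distinct, and whose negative
parts are distinct, congruent to `3` modulo `4` and less than twice the number of positive
parts. -/
def signedH (n : ℤ) : Set (SignedPartition n) :=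
  {σ | σ.pos.parts.Nodup ∧ (∀ x ∈ σ.pos.parts, Even x) ∧
    σ.neg.parts.Nodup ∧
    (∀ y ∈ σ.neg.parts, y ≡ 3 [MOD 4] ∧ y < 2 * σ.pos.parts.card)}

/-! Write `p = X ^ 2`. Splitting by the number `k` of parts, the left side has generating function
`∑ evenSeries k * ∏_{i<k} (1 + X * p ^ i)`, by a recursion on the smallest part. On the right, `k =
2K` and `k = 2K + 1` allow the same negative parts `3, 7, …, 4K - 1`, so consecutive terms merge
into one over `(1 - p) ⋯ (1 - p ^ (2K + 1))`.

The two series are compared by replacing a suitable `X` with a free `z`. Both z-series satisfy `F(z)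
= (1 + z p) F(z p ^ 2)` and agree at `z = 0`, hence everywhere: iteration drives the argument to `0`
in the `X`-adic topology. To avoid infinite sums the proof truncates, with an explicit telescoped
error in each functional equation (`signedSum_sub`, `gollnitzSum_sub`).
`X_pow_dvd_signedSum_sub_gollnitzSum` then gives agreement modulo `X ^ N`, and taking `N = n + 1`
settles the coefficient of `X ^ n`. -/

open PowerSeries

/-! ### q-Pochhammer identities in `X ^ 2` -/

/-- The reciprocal of `(1 - p) (1 - p ^ 2) ⋯ (1 - p ^ k)` at `p = X ^ 2`. -/
noncomputable def recipPoch (k : ℕ) : ℚ⟦X⟧ :=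
  ∏ i ∈ Finset.range k, (1 - (X ^ 2 : ℚ⟦X⟧) ^ (i + 1))⁻¹

lemma one_sub_mul_recipPoch_succ (k : ℕ) :
    (1 - (X ^ 2 : ℚ⟦X⟧) ^ (k + 1)) * recipPoch (k + 1) = recipPoch k := by
  have h : (1 - (X ^ 2 : ℚ⟦X⟧) ^ (k + 1)) * (1 - (X ^ 2 : ℚ⟦X⟧) ^ (k + 1))⁻¹ = 1 := by
    apply PowerSeries.mul_inv_cancel
    simp
  rw [recipPoch, Finset.prod_range_succ, ← recipPoch]
  linear_combination recipPoch k * h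

/-- The generating function of the sets of `k` even positive integers. -/
noncomputable def evenSeries (k : ℕ) : ℚ⟦X⟧ :=
  (X ^ 2 : ℚ⟦X⟧) ^ (k * (k + 1) / 2) * recipPoch k

lemma succ_triangle (k : ℕ) : (k + 1) * (k + 1 + 1) / 2 = k * (k + 1) / 2 + (k + 1) := by
  rw [show (k + 1) * (k + 1 + 1) = k * (k + 1) + (k + 1) * 2 by ring,
    Nat.add_mul_div_right _ _ two_pos]

lemma one_sub_mul_evenSeries_succ (k : ℕ) :
    (1 - (X ^ 2 : ℚ⟦X⟧) ^ (k + 1)) * evenSeries (k + 1) =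
      (X ^ 2 : ℚ⟦X⟧) ^ (k + 1) * evenSeries k := by
  rw [evenSeries, evenSeries, ← one_sub_mul_recipPoch_succ k, succ_triangle, pow_add]
  ring

lemma evenSeries_add_evenSeries (K : ℕ) :
    evenSeries (2 * K) + evenSeries (2 * K + 1) =
      (X ^ 2 : ℚ⟦X⟧) ^ (K * (2 * K + 1)) * recipPoch (2 * K + 1) := by
  have h := one_sub_mul_recipPoch_succ (2 * K)
  rw [evenSeries, evenSeries, succ_triangle,
    show 2 * K * (2 * K + 1) / 2 = K * (2 * K + 1) by
      rw [mul_assoc, Nat.mul_div_cancel_left _ two_pos], ← h, pow_add]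
  ring

/-! ### Truncated series in `z` and their functional equation -/

/-- Partial sums of a `z`-analogue of the generating function of `signedH`. -/
noncomputable def signedSum (N : ℕ) (z : ℚ⟦X⟧) : ℚ⟦X⟧ :=
  ∑ K ∈ Finset.range N, (X ^ 2 : ℚ⟦X⟧) ^ (K ^ 2) *
    (∏ b ∈ Finset.range K, (z + (X ^ 2) ^ (2 * (b + 1)))) * recipPoch (2 * K + 1)

/-- Partial sums of a `z`-analogue of the generating function of `LG₂`. -/
noncomputable def gollnitzSum (N : ℕ) (z : ℚ⟦X⟧) : ℚ⟦X⟧ :=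
  ∑ k ∈ Finset.range N, evenSeries k * ∏ i ∈ Finset.range k, (1 + z * (X ^ 2) ^ i)

/-- Each factor is `p ^ 2` times its predecessor in the unscaled product, so scaling `z` by `p ^ 2`
only gains the factor `z + 1` and loses the last one. -/
lemma prod_range_scaled (p z : ℚ⟦X⟧) (N : ℕ) :
    ∏ b ∈ Finset.range (N + 1), (z * p ^ 2 + p ^ (2 * (b + 1))) =
      p ^ (2 * (N + 1)) * (z + 1) * ∏ b ∈ Finset.range N, (z + p ^ (2 * (b + 1))) := by
  have h : ∀ b, z * p ^ 2 + p ^ (2 * (b + 1)) = p ^ 2 * (z + p ^ (2 * b)) := fun b ↦ by ring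
  simp_rw [h]
  rw [Finset.prod_mul_distrib, Finset.prod_const, Finset.card_range, Finset.prod_range_succ']
  ring

/-- The defect telescopes: the new summand's contribution cancels the previous error, after two
denominator factors are cleared, and leaves the next one. -/
lemma signedSum_sub (N : ℕ) (z : ℚ⟦X⟧) :
    signedSum (N + 1) z - (1 + z * X ^ 2) * signedSum (N + 1) (z * (X ^ 2) ^ 2) =
      -(z * (X ^ 2) ^ ((N + 1) ^ 2) * (∏ b ∈ Finset.range N, (z + (X ^ 2) ^ (2 * (b + 1)))) *
        recipPoch (2 * N + 1)) := by
  induction N with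
  | zero => simp [signedSum]; ring
  | succ N ih =>
    have h1 := one_sub_mul_recipPoch_succ (2 * N + 1)
    have h2 := one_sub_mul_recipPoch_succ (2 * N + 2)
    rw [← h2] at h1
    rw [← h1] at ih
    unfold signedSum at ih ⊢
    rw [Finset.sum_range_succ, Finset.sum_range_succ _ (N + 1), prod_range_scaled,
      Finset.prod_range_succ _ N]
    rw [show 2 * (N + 1) + 1 = 2 * N + 2 + 1 by ring]
    linear_combination ih

lemma gollnitzSum_sub (N : ℕ) (z : ℚ⟦X⟧) :
    gollnitzSum (N + 1) z - (1 + z * X ^ 2) * gollnitzSum (N + 1) (z * (X ^ 2) ^ 2) =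
      -(z * (X ^ 2) ^ (N + 1) * evenSeries N *
        ∏ i ∈ Finset.range N, (1 + z * (X ^ 2) ^ (i + 1))) := by
  induction N with
  | zero => simp [gollnitzSum, evenSeries, recipPoch]
  | succ N ih =>
    have h1 := one_sub_mul_evenSeries_succ N
    -- Both products at `k = N + 1` share the factors with exponents `1, …, N`; the rest is `1 + z`
    -- against the two factors with exponents `N + 1` and `N + 2`.
    have h2 : (1 + z * X ^ 2) * ∏ i ∈ Finset.range (N + 1), (1 + z * (X ^ 2) ^ 2 * (X ^ 2) ^ i) =
        (∏ i ∈ Finset.range N, (1 + z * (X ^ 2) ^ (i + 1))) * (1 + z * (X ^ 2) ^ (N + 1)) *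
          (1 + z * (X ^ 2) ^ (N + 1 + 1)) := by
      rw [← Finset.prod_range_succ, ← Finset.prod_range_succ, Finset.prod_range_succ' _ (N + 1),
        mul_comm]
      simp only [zero_add, pow_one]
      congr 1
      refine Finset.prod_congr rfl fun i _ ↦ ?_
      ring
    have h3 : ∏ i ∈ Finset.range (N + 1), (1 + z * (X ^ 2 : ℚ⟦X⟧) ^ i) =
        (1 + z) * ∏ i ∈ Finset.range N, (1 + z * (X ^ 2) ^ (i + 1)) := by
      rw [Finset.prod_range_succ', mul_comm]
      simp
    unfold gollnitzSum at ih ⊢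
    rw [Finset.sum_range_succ, Finset.sum_range_succ _ (N + 1), h3]
    rw [Finset.prod_range_succ (fun i ↦ 1 + z * (X ^ 2 : ℚ⟦X⟧) ^ (i + 1))]
    linear_combination ih - evenSeries (N + 1) * h2 +
      z * (∏ i ∈ Finset.range N, (1 + z * (X ^ 2) ^ (i + 1))) * h1

/-- At `z = 0` the K-th product is `p ^ (K * (K + 1))`, and `K ^ 2 + K * (K + 1) = K * (2 * K + 1)`
is the exponent of the merged pair in `evenSeries_add_evenSeries`. -/
lemma signedSum_zero_eq (N : ℕ) : signedSum N 0 = gollnitzSum (2 * N) 0 := by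
  induction N with
  | zero => simp [signedSum, gollnitzSum]
  | succ N ih =>
    have h : ∏ b ∈ Finset.range N, (0 + (X ^ 2 : ℚ⟦X⟧) ^ (2 * (b + 1))) =
        (X ^ 2) ^ (N * (N + 1)) := by
      simp only [zero_add]
      rw [Finset.prod_pow_eq_pow_sum, ← Finset.mul_sum, Finset.sum_add_distrib]
      congr 1
      have := Finset.sum_range_id_mul_two N
      cases N <;> simp at *; nlinarith
    have h2 := evenSeries_add_evenSeries N
    rw [signedSum, Finset.sum_range_succ, ← signedSum, ih, h, show 2 * (N + 1) = 2 * N + 1 + 1 by ring,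
      gollnitzSum, gollnitzSum, Finset.sum_range_succ, Finset.sum_range_succ]
    simp only [zero_mul, add_zero, Finset.prod_const_one, mul_one]
    rw [add_assoc, h2]
    ring

/-- The difference is a polynomial in `z` over the power series, and it vanishes at `0`. -/
lemma sub_dvd_signedSum_sub_gollnitzSum (N : ℕ) (z : ℚ⟦X⟧) :
    z ∣ signedSum N z - gollnitzSum (2 * N) z := by
  set P : Polynomial ℚ⟦X⟧ :=
    ∑ K ∈ Finset.range N, Polynomial.C ((X ^ 2 : ℚ⟦X⟧) ^ (K ^ 2)) *
      (∏ b ∈ Finset.range K, (Polynomial.X + Polynomial.C ((X ^ 2) ^ (2 * (b + 1))))) *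
        Polynomial.C (recipPoch (2 * K + 1)) -
    ∑ k ∈ Finset.range (2 * N), Polynomial.C (evenSeries k) *
      ∏ i ∈ Finset.range k, (1 + Polynomial.X * Polynomial.C ((X ^ 2) ^ i)) with hP
  have h : ∀ w, P.eval w = signedSum N w - gollnitzSum (2 * N) w := by
    intro w
    simp only [hP, signedSum, gollnitzSum, Polynomial.eval_sub, Polynomial.eval_finsetSum, Polynomial.eval_mul, Polynomial.eval_prod,
      Polynomial.eval_add, Polynomial.eval_X, Polynomial.eval_C, Polynomial.eval_one]
  have := Polynomial.sub_dvd_eval_sub z 0 P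
  rwa [h, h, signedSum_zero_eq, sub_self, sub_zero, sub_zero] at this

lemma X_pow_dvd_signedSum_sub_gollnitzSum (N : ℕ) (z : ℚ⟦X⟧) :
    (X : ℚ⟦X⟧) ^ N ∣ signedSum N z - gollnitzSum (2 * N) z := by
  obtain _ | N := N
  · simp
  have step : ∀ z : ℚ⟦X⟧, (X : ℚ⟦X⟧) ^ (N + 1) ∣
      (signedSum (N + 1) z - gollnitzSum (2 * (N + 1)) z) - (1 + z * X ^ 2) *
        (signedSum (N + 1) (z * (X ^ 2) ^ 2) - gollnitzSum (2 * (N + 1)) (z * (X ^ 2) ^ 2)) := by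
    intro z
    have h1 := signedSum_sub N z
    have h2 := gollnitzSum_sub (2 * N + 1) z
    rw [show 2 * (N + 1) = 2 * N + 1 + 1 by ring]
    have d1 : (X : ℚ⟦X⟧) ^ (N + 1) ∣ (X ^ 2) ^ ((N + 1) ^ 2) := by
      rw [← pow_mul]; exact pow_dvd_pow _ (by nlinarith)
    have d2 : (X : ℚ⟦X⟧) ^ (N + 1) ∣ (X ^ 2) ^ (2 * N + 1 + 1) := by
      rw [← pow_mul]; exact pow_dvd_pow _ (by nlinarith)
    obtain ⟨a, ha⟩ := d1
    obtain ⟨b, hb⟩ := d2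
    rw [ha] at h1
    rw [hb] at h2
    refine ⟨-(z * a * (∏ b ∈ Finset.range N, (z + (X ^ 2) ^ (2 * (b + 1)))) *
        recipPoch (2 * N + 1)) + (z * b * evenSeries (2 * N + 1) *
        ∏ i ∈ Finset.range (2 * N + 1), (1 + z * (X ^ 2) ^ (i + 1))), ?_⟩
    linear_combination h1 - h2
  -- Downward induction on the power `j` of `X` known to divide `z`: the functional equation passes
  -- to `z * X ^ 4`, and once `j = N + 1` divisibility by `z` suffices. Gaining one power of `X` per
  -- step is enough.
  have main : ∀ (d j : ℕ), N + 1 = j + d → ∀ z : ℚ⟦X⟧, (X : ℚ⟦X⟧) ^ j ∣ z →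
      (X : ℚ⟦X⟧) ^ (N + 1) ∣ signedSum (N + 1) z - gollnitzSum (2 * (N + 1)) z := by
    intro d
    induction d with
    | zero =>
      intro j hj z hz
      rw [hj]
      exact hz.trans (hj ▸ sub_dvd_signedSum_sub_gollnitzSum _ _)
    | succ d ih =>
      intro j hj z hz
      refine (dvd_iff_dvd_of_dvd_sub (step z)).2 (Dvd.dvd.mul_left (ih (j + 1) (by omega) _ ?_) _)
      rw [pow_succ]
      exact mul_dvd_mul hz ⟨X ^ 3, by ring⟩
  exact main (N + 1) 0 (by simp) z (by simp)

/-! ### Generating functions of families of finite sets -/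

/-- The generating function of a family of finite sets of natural numbers by their sums. -/
noncomputable def sumSeries (s : Set (Finset ℕ)) : ℚ⟦X⟧ :=
  PowerSeries.mk fun n ↦ ({S ∈ s | S.sum id = n}.ncard : ℚ)

lemma finite_pos_sum_eq {s : Set (Finset ℕ)} (n : ℕ) :
    {S ∈ s | S.sum id = n}.Finite := by
  refine (Finset.range (n + 1)).powerset.finite_toSet.subset fun S hS ↦ ?_
  simp only [Finset.coe_powerset, Set.mem_preimage, Set.mem_powerset_iff, Finset.coe_subset]
  intro x hx
  have := Finset.single_le_sum (f := id) (fun i _ ↦ Nat.zero_le i) hx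
  have := hS.2
  simp only [id] at *
  rw [Finset.mem_range]
  omega

lemma sumSeries_union {s t : Set (Finset ℕ)} (h : Disjoint s t) :
    sumSeries (s ∪ t) = sumSeries s + sumSeries t := by
  ext n
  simp only [sumSeries, coeff_mk, map_add]
  rw [← Nat.cast_add, ← Set.ncard_union_eq _ (finite_pos_sum_eq n) (finite_pos_sum_eq n)]
  · congr 2
    ext S
    simp only [Set.mem_ofPred_eq, Set.mem_union]
    tauto
  · exact h.mono (fun S hS ↦ hS.1) fun S hS ↦ hS.1

lemma sumSeries_image {s : Set (Finset ℕ)} {f : Finset ℕ → Finset ℕ} {d : ℕ}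
    (hf : Set.InjOn f s) (hd : ∀ S ∈ s, (f S).sum id = S.sum id + d) :
    sumSeries (f '' s) = X ^ d * sumSeries s := by
  ext n
  simp only [sumSeries, coeff_mk, coeff_X_pow_mul']
  have h : {S ∈ f '' s | S.sum id = n} = f '' {S ∈ s | S.sum id + d = n} := by
    ext S
    constructor
    · rintro ⟨⟨T, hT, rfl⟩, h⟩
      exact ⟨T, ⟨hT, by rw [← h, hd T hT]⟩, rfl⟩
    · rintro ⟨T, ⟨hT, h⟩, rfl⟩
      exact ⟨⟨T, hT, rfl⟩, by rw [← h, hd T hT]⟩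
  rw [h, (hf.mono fun S hS ↦ hS.1).ncard_image]
  split_ifs with hn
  · congr 3
    ext S
    have : S.sum id + d = n ↔ S.sum id = n - d := by omega
    rw [this]
  · have : {S ∈ s | S.sum id + d = n} = ∅ := by
      ext S
      simp only [Set.mem_ofPred_eq, Set.mem_empty_iff_false, iff_false]
      omega
    rw [this]
    simp

/-- Add `d` to all elements of a finite set. -/
def shiftSet (d : ℕ) (S : Finset ℕ) : Finset ℕ := S.map (addRightEmbedding d)

lemma mem_shiftSet {d x : ℕ} {S : Finset ℕ} : x ∈ shiftSet d S ↔ ∃ y ∈ S, y + d = x := by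
  simp [shiftSet]

lemma card_shiftSet (d : ℕ) (S : Finset ℕ) : (shiftSet d S).card = S.card := Finset.card_map _

lemma sum_shiftSet (d : ℕ) (S : Finset ℕ) :
    (shiftSet d S).sum id = S.sum id + S.card * d := by
  simp [shiftSet, Finset.sum_add_distrib]

lemma shiftSet_injective (d : ℕ) : Function.Injective (shiftSet d) := Finset.map_injective _

lemma exists_shiftSet_eq {d : ℕ} {S : Finset ℕ} (h : ∀ x ∈ S, d ≤ x) : ∃ T, shiftSet d T = S := by
  refine ⟨S.image (· - d), ?_⟩
  ext x
  simp only [mem_shiftSet, Finset.mem_image]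
  constructor
  · rintro ⟨_, ⟨y, hy, rfl⟩, rfl⟩
    rwa [Nat.sub_add_cancel (h y hy)]
  · intro hx
    exact ⟨x - d, ⟨x, hx, rfl⟩, Nat.sub_add_cancel (h x hx)⟩

lemma insert_shiftSet_injOn {a d : ℕ} {s : Set (Finset ℕ)}
    (h : ∀ S ∈ s, a ∉ shiftSet d S) : Set.InjOn (fun S ↦ insert a (shiftSet d S)) s := by
  intro S hS T hT hST
  apply shiftSet_injective d
  have := congrArg (fun U ↦ U.erase a) hST
  simpa only [Finset.erase_insert (h S hS), Finset.erase_insert (h T hT)] using this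

/-- Sets of `k` positive even integers. -/
def evenSets (k : ℕ) : Set (Finset ℕ) := {S | S.card = k ∧ ∀ x ∈ S, 0 < x ∧ Even x}

/-- Part sets, of size `k`, of second little Göllnitz partitions. -/
def gollnitzSets (k : ℕ) : Set (Finset ℕ) :=
  {S | S.card = k ∧ (∀ x ∈ S, 2 ≤ x) ∧ (∀ x ∈ S, ∀ y ∈ S, y < x → y + 2 ≤ x) ∧
    (∀ x ∈ S, ∀ y ∈ S, Odd x → Odd y → y < x → y + 4 ≤ x)}

lemma sumSeries_shiftSet {k d : ℕ} {s : Set (Finset ℕ)} (h : ∀ S ∈ s, S.card = k) :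
    sumSeries (shiftSet d '' s) = X ^ (k * d) * sumSeries s :=
  sumSeries_image (shiftSet_injective d).injOn fun S hS ↦ by rw [sum_shiftSet, h S hS]

lemma sumSeries_insert_shiftSet {a k d : ℕ} {s : Set (Finset ℕ)} (hk : ∀ S ∈ s, S.card = k)
    (h : ∀ S ∈ s, a ∉ shiftSet d S) :
    sumSeries ((fun S ↦ insert a (shiftSet d S)) '' s) = X ^ (a + k * d) * sumSeries s :=
  sumSeries_image (insert_shiftSet_injOn h) fun S hS ↦ by
    rw [Finset.sum_insert (h S hS), sum_shiftSet, hk S hS, id]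
    ring

lemma sumSeries_singleton_empty {s : Set (Finset ℕ)} (h : s = {∅}) : sumSeries s = 1 := by
  ext n
  simp only [sumSeries, coeff_mk, coeff_one, h]
  split_ifs with hn
  · have : {S ∈ ({∅} : Set (Finset ℕ)) | S.sum id = n} = {∅} := by
      ext S
      simp only [Set.mem_ofPred_eq, Set.mem_singleton_iff, and_iff_left_iff_imp]
      rintro rfl
      simp [hn]
    rw [this]
    simp
  · have : {S ∈ ({∅} : Set (Finset ℕ)) | S.sum id = n} = ∅ := by
      ext S
      simp only [Set.mem_ofPred_eq, Set.mem_singleton_iff, Set.mem_empty_iff_false, iff_false]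
      rintro ⟨rfl, h⟩
      exact hn (by simpa using h.symm)
    rw [this]
    simp

/-! ### Recursions on the smallest part -/

lemma evenSets_succ (k : ℕ) : evenSets (k + 1) =
    shiftSet 2 '' evenSets (k + 1) ∪ (fun S ↦ insert 2 (shiftSet 2 S)) '' evenSets k := by
  ext S
  constructor
  · rintro ⟨hc, hS⟩
    by_cases h2 : 2 ∈ S
    · right
      obtain ⟨T, hT⟩ := exists_shiftSet_eq (d := 2) (S := S.erase 2) (by grind)
      have hT' : ∀ x, x ∈ T → x + 2 ∈ S.erase 2 := fun x hx ↦ hT ▸ mem_shiftSet.2 ⟨x, hx, rfl⟩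
      refine ⟨T, ⟨?_, ?_⟩, ?_⟩
      · rw [← card_shiftSet 2, hT, Finset.card_erase_of_mem h2, hc]; rfl
      · intro x hx
        have := hT' x hx
        grind
      · simp only [hT]
        exact Finset.insert_erase h2
    · left
      obtain ⟨T, hT⟩ := exists_shiftSet_eq (d := 2) (S := S) (by grind)
      have hT' : ∀ x, x ∈ T → x + 2 ∈ S := fun x hx ↦ hT ▸ mem_shiftSet.2 ⟨x, hx, rfl⟩
      refine ⟨T, ⟨?_, ?_⟩, hT⟩
      · rw [← card_shiftSet 2, hT, hc]
      · intro x hx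
        have := hT' x hx
        grind
  · rintro (⟨T, ⟨hc, hT⟩, rfl⟩ | ⟨T, ⟨hc, hT⟩, rfl⟩)
    · refine ⟨by rw [card_shiftSet, hc], ?_⟩
      intro x hx
      obtain ⟨y, hy, rfl⟩ := mem_shiftSet.1 hx
      have := hT y hy
      grind
    · have h2 : 2 ∉ shiftSet 2 T := by
        rw [mem_shiftSet]
        grind
      refine ⟨by rw [Finset.card_insert_of_notMem h2, card_shiftSet, hc], ?_⟩
      intro x hx
      rcases Finset.mem_insert.1 hx with rfl | hx
      · exact ⟨two_pos, even_two⟩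
      obtain ⟨y, hy, rfl⟩ := mem_shiftSet.1 hx
      have := hT y hy
      grind

/-- Cases: no part `2` or `3`; smallest part `2`; smallest part `3`. In the last, `4` and `5` are
excluded by the two gap conditions, so the other parts are at least `6` and can drop by `4`. -/
lemma gollnitzSets_succ (k : ℕ) : gollnitzSets (k + 1) =
    shiftSet 2 '' gollnitzSets (k + 1) ∪ ((fun S ↦ insert 2 (shiftSet 2 S)) '' gollnitzSets k ∪
      (fun S ↦ insert 3 (shiftSet 4 S)) '' gollnitzSets k) := by
  ext S
  constructor
  · rintro ⟨hc, h2, hd, ho⟩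
    by_cases m2 : 2 ∈ S
    · right; left
      obtain ⟨T, hT⟩ := exists_shiftSet_eq (d := 2) (S := S.erase 2) (by grind)
      have hT' : ∀ x, x ∈ T → x + 2 ∈ S.erase 2 := fun x hx ↦ hT ▸ mem_shiftSet.2 ⟨x, hx, rfl⟩
      refine ⟨T, ⟨?_, ?_, ?_, ?_⟩, ?_⟩
      · rw [← card_shiftSet 2, hT, Finset.card_erase_of_mem m2, hc]; rfl
      · intro x hx
        have := hT' x hx
        grind
      · intro x hx y hy
        have := hT' x hx
        have := hT' y hy
        grind
      · intro x hx y hy hxo hyo hxy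
        have := ho _ (Finset.mem_of_mem_erase (hT' x hx)) _ (Finset.mem_of_mem_erase (hT' y hy))
          (by grind) (by grind) (by omega)
        omega
      · simp only [hT]
        exact Finset.insert_erase m2
    by_cases m3 : 3 ∈ S
    · right; right
      have h6 : ∀ x ∈ S.erase 3, 6 ≤ x := by
        intro x hx
        obtain ⟨hx3, hx⟩ := Finset.mem_erase.1 hx
        have a := h2 x hx
        have b : x ≠ 2 := fun h ↦ m2 (h ▸ hx)
        have c := hd x hx 3 m3 (by omega)
        have d : x ≠ 5 := by
          rintro rfl
          have := ho 5 hx 3 m3 (by decide) (by decide) (by omega)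
          omega
        omega
      obtain ⟨T, hT⟩ := exists_shiftSet_eq (d := 4) (S := S.erase 3)
        fun x hx ↦ by have := h6 x hx; omega
      have hT' : ∀ x, x ∈ T → x + 4 ∈ S.erase 3 := fun x hx ↦ hT ▸ mem_shiftSet.2 ⟨x, hx, rfl⟩
      refine ⟨T, ⟨?_, ?_, ?_, ?_⟩, ?_⟩
      · rw [← card_shiftSet 4, hT, Finset.card_erase_of_mem m3, hc]; rfl
      · intro x hx
        have := h6 _ (hT' x hx)
        omega
      · intro x hx y hy
        have := hT' x hx
        have := hT' y hy
        grind
      · intro x hx y hy hxo hyo hxy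
        have := ho _ (Finset.mem_of_mem_erase (hT' x hx)) _ (Finset.mem_of_mem_erase (hT' y hy))
          (by grind) (by grind) (by omega)
        omega
      · simp only [hT]
        exact Finset.insert_erase m3
    · left
      have h4 : ∀ x ∈ S, 4 ≤ x := by
        intro x hx
        have a := h2 x hx
        have b : x ≠ 2 := fun h ↦ m2 (h ▸ hx)
        have c : x ≠ 3 := fun h ↦ m3 (h ▸ hx)
        omega
      obtain ⟨T, hT⟩ := exists_shiftSet_eq (d := 2) (S := S) (by grind)
      have hT' : ∀ x, x ∈ T → x + 2 ∈ S := fun x hx ↦ hT ▸ mem_shiftSet.2 ⟨x, hx, rfl⟩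
      refine ⟨T, ⟨?_, ?_, ?_, ?_⟩, hT⟩
      · rw [← card_shiftSet 2, hT, hc]
      · intro x hx
        have := h4 _ (hT' x hx)
        omega
      · intro x hx y hy
        have := hT' x hx
        have := hT' y hy
        grind
      · intro x hx y hy hxo hyo hxy
        have := ho _ (hT' x hx) _ (hT' y hy) (by grind) (by grind) (by omega)
        omega
  · have gap : ∀ T d, Even d → (∀ x ∈ T, ∀ y ∈ T, Odd x → Odd y → y < x → y + 4 ≤ x) →
        ∀ x ∈ shiftSet d T, ∀ y ∈ shiftSet d T, Odd x → Odd y → y < x → y + 4 ≤ x := by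
      intro T d hd ho x hx y hy hxo hyo hxy
      obtain ⟨x, hx', rfl⟩ := mem_shiftSet.1 hx
      obtain ⟨y, hy', rfl⟩ := mem_shiftSet.1 hy
      have := ho x hx' y hy' (by grind) (by grind) (by omega)
      omega
    have gap2 : ∀ T d, (∀ x ∈ T, ∀ y ∈ T, y < x → y + 2 ≤ x) →
        ∀ x ∈ shiftSet d T, ∀ y ∈ shiftSet d T, y < x → y + 2 ≤ x := by
      intro T d hd x hx y hy hxy
      obtain ⟨x, hx', rfl⟩ := mem_shiftSet.1 hx
      obtain ⟨y, hy', rfl⟩ := mem_shiftSet.1 hy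
      have := hd x hx' y hy' (by omega)
      omega
    have low : ∀ T d, (∀ x ∈ T, 2 ≤ x) → ∀ x ∈ shiftSet d T, d + 2 ≤ x := by
      intro T d h x hx
      obtain ⟨x, hx', rfl⟩ := mem_shiftSet.1 hx
      have := h x hx'
      omega
    rintro (⟨T, ⟨hc, h2, hd, ho⟩, rfl⟩ | ⟨T, ⟨hc, h2, hd, ho⟩, rfl⟩ | ⟨T, ⟨hc, h2, hd, ho⟩, rfl⟩)
    · refine ⟨by rw [card_shiftSet, hc], fun x hx ↦ ?_, gap2 T 2 hd, gap T 2 even_two ho⟩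
      have := low T 2 h2 x hx
      omega
    · have l := low T 2 h2
      have g2 := gap2 T 2 hd
      have g := gap T 2 even_two ho
      have n2 : 2 ∉ shiftSet 2 T := fun h ↦ by have := l 2 h; omega
      refine ⟨by rw [Finset.card_insert_of_notMem n2, card_shiftSet, hc], ?_, ?_, ?_⟩
      · grind
      · grind
      · intro x hx y hy hxo hyo
        have hx' : x ∈ shiftSet 2 T := by
          rcases Finset.mem_insert.1 hx with rfl | h
          · exact absurd hxo (by decide)
          · exact h
        have hy' : y ∈ shiftSet 2 T := by
          rcases Finset.mem_insert.1 hy with rfl | h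
          · exact absurd hyo (by decide)
          · exact h
        exact g x hx' y hy' hxo hyo
    · have l := low T 4 h2
      have g2 := gap2 T 4 hd
      have g := gap T 4 (by decide) ho
      have n3 : 3 ∉ shiftSet 4 T := fun h ↦ by have := l 3 h; omega
      refine ⟨by rw [Finset.card_insert_of_notMem n3, card_shiftSet, hc], ?_, ?_, ?_⟩
      · grind
      · grind
      · intro x hx y hy hxo hyo hxy
        rcases Finset.mem_insert.1 hx with rfl | hx' <;> rcases Finset.mem_insert.1 hy with rfl | hy'
        · omega
        · have := l y hy'; omega
        · have := l x hx'
          have : x ≠ 6 := by rintro rfl; exact absurd hxo (by decide)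
          omega
        · exact g x hx' y hy' hxo hyo hxy

lemma one_sub_X_sq_pow_ne_zero (k : ℕ) : (1 - (X ^ 2 : ℚ⟦X⟧) ^ (k + 1)) ≠ 0 := by
  intro h
  have := congrArg constantCoeff h
  simp at this

lemma sumSeries_evenSets (k : ℕ) : sumSeries (evenSets k) = evenSeries k := by
  induction k with
  | zero =>
    rw [sumSeries_singleton_empty]
    · simp [evenSeries, recipPoch]
    · ext S
      simp only [evenSets, Finset.card_eq_zero, Set.mem_ofPred_eq, Set.mem_singleton_iff,
        and_iff_left_iff_imp]
      rintro rfl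
      simp
  | succ k ih =>
    have hcard : ∀ k, ∀ S ∈ evenSets k, S.card = k := fun k S hS ↦ hS.1
    have hpos : ∀ k, ∀ S ∈ evenSets k, 2 ∉ shiftSet 2 S := by
      intro k S hS h
      obtain ⟨x, hx, h⟩ := mem_shiftSet.1 h
      have := hS.2 x hx
      omega
    have h : sumSeries (evenSets (k + 1)) = X ^ ((k + 1) * 2) * sumSeries (evenSets (k + 1)) +
        X ^ (2 + k * 2) * sumSeries (evenSets k) := by
      conv_lhs => rw [evenSets_succ]
      rw [sumSeries_union, sumSeries_shiftSet (hcard _),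
        sumSeries_insert_shiftSet (hcard _) (hpos _)]
      rw [Set.disjoint_left]
      rintro _ ⟨S, hS, rfl⟩ ⟨T, hT, h⟩
      exact hpos _ S hS (h ▸ Finset.mem_insert_self _ _)
    apply mul_left_cancel₀ (one_sub_X_sq_pow_ne_zero k)
    rw [one_sub_mul_evenSeries_succ, ← ih, ← pow_mul]
    linear_combination h

lemma sumSeries_gollnitzSets (k : ℕ) : sumSeries (gollnitzSets k) =
    evenSeries k * ∏ i ∈ Finset.range k, (1 + X * (X ^ 2) ^ i) := by
  induction k with
  | zero =>
    rw [sumSeries_singleton_empty]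
    · simp [evenSeries, recipPoch]
    · ext S
      simp only [gollnitzSets, Finset.card_eq_zero, Set.mem_ofPred_eq, Set.mem_singleton_iff,
        and_iff_left_iff_imp]
      rintro rfl
      simp
  | succ k ih =>
    have hcard : ∀ k, ∀ S ∈ gollnitzSets k, S.card = k := fun k S hS ↦ hS.1
    have hlow : ∀ k d a, a < d + 2 → ∀ S ∈ gollnitzSets k, a ∉ shiftSet d S := by
      intro k d a had S hS h
      obtain ⟨x, hx, h⟩ := mem_shiftSet.1 h
      have := hS.2.1 x hx
      omega
    have h : sumSeries (gollnitzSets (k + 1)) =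
        X ^ ((k + 1) * 2) * sumSeries (gollnitzSets (k + 1)) +
        (X ^ (2 + k * 2) * sumSeries (gollnitzSets k) +
          X ^ (3 + k * 4) * sumSeries (gollnitzSets k)) := by
      conv_lhs => rw [gollnitzSets_succ]
      rw [sumSeries_union, sumSeries_union, sumSeries_shiftSet (hcard _),
        sumSeries_insert_shiftSet (hcard _) (hlow _ 2 2 (by omega)),
        sumSeries_insert_shiftSet (hcard _) (hlow _ 4 3 (by omega))]
      · rw [Set.disjoint_left]
        rintro _ ⟨S, hS, rfl⟩ ⟨T, hT, h⟩
        have h2 : 2 ∈ insert 3 (shiftSet 4 T) := by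
          simp only at h
          exact h ▸ Finset.mem_insert_self _ _
        exact hlow _ 4 2 (by omega) T hT (Finset.mem_of_mem_insert_of_ne h2 (by omega))
      · rw [Set.disjoint_left]
        rintro _ ⟨S, hS, rfl⟩ (⟨T, hT, h⟩ | ⟨T, hT, h⟩)
        · exact hlow _ 2 2 (by omega) S hS (h ▸ Finset.mem_insert_self _ _)
        · exact hlow _ 2 3 (by omega) S hS (h ▸ Finset.mem_insert_self _ _)
    -- The two insertion terms combine as `X ^ (2 + 2k) + X ^ (3 + 4k) = p ^ (k + 1) * (1 + X * p ^
    -- k)`, with `p = X ^ 2`.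
    apply mul_left_cancel₀ (one_sub_X_sq_pow_ne_zero k)
    rw [← mul_assoc, one_sub_mul_evenSeries_succ, Finset.prod_range_succ]
    rw [ih] at h
    linear_combination h

lemma ncard_eq_sum_ncard_fiber {α β : Type*} {s : Set α} (hs : s.Finite) (g : α → β)
    (t : Finset β) (h : ∀ a ∈ s, g a ∈ t) : s.ncard = ∑ b ∈ t, {a ∈ s | g a = b}.ncard := by
  classical
  lift s to Finset α using hs
  rw [Set.ncard_coe_finset, Finset.card_eq_sum_card_fiberwise h]
  refine Finset.sum_congr rfl fun b _ ↦ ?_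
  rw [← Set.ncard_coe_finset]
  simp

/-! ### Counting signed partitions as pairs of sets -/

/-- The map `b ↦ 4 * b + 3`. -/
def fourMulAddThree : ℕ ↪ ℕ := ⟨fun b ↦ 4 * b + 3, fun a b h ↦ by grind⟩

lemma fourMulAddThree_apply (b : ℕ) : fourMulAddThree b = 4 * b + 3 := rfl

/-- The set `{3, 7, …, 4 K - 1}`. -/
def negParts (K : ℕ) : Finset ℕ := (Finset.range K).map fourMulAddThree

lemma mem_negParts {k y : ℕ} : y ∈ negParts (k / 2) ↔ y ≡ 3 [MOD 4] ∧ y < 2 * k := by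
  simp only [negParts, Finset.mem_map, Finset.mem_range, fourMulAddThree_apply, Nat.ModEq]
  constructor
  · rintro ⟨b, hb, rfl⟩
    omega
  · rintro ⟨h, hk⟩
    exact ⟨y / 4, by omega, by omega⟩

lemma negParts_mono {K L : ℕ} (h : K ≤ L) : negParts K ⊆ negParts L :=
  Finset.map_subset_map.2 (Finset.range_mono h)

lemma sum_negParts (K : ℕ) : (negParts K).sum id = 2 * K ^ 2 + K := by
  induction K with
  | zero => rfl
  | succ K ih =>
    simp only [negParts, Finset.sum_map, fourMulAddThree_apply, id] at ih ⊢
    rw [Finset.sum_range_succ, ih]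
    ring

/-- The pairs of sets of positive and negative parts of the signed partitions in `signedH n`. -/
def signedPairs (n : ℕ) : Set (Finset ℕ × Finset ℕ) :=
  {P | (∀ x ∈ P.1, 0 < x ∧ Even x) ∧ P.2 ⊆ negParts (P.1.card / 2) ∧
    P.1.sum id = n + P.2.sum id}

lemma card_mul_le_sum {S : Finset ℕ} (hS : ∀ x ∈ S, 0 < x ∧ Even x) :
    S.card * (S.card + 1) ≤ S.sum id := by
  by_contra! h
  -- The sum is below the order of `evenSeries`, so no such set could be counted there.
  have h0 : coeff (S.sum id) (evenSeries S.card) = 0 := by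
    rw [evenSeries, ← pow_mul, coeff_X_pow_mul', if_neg]
    rw [Nat.mul_div_cancel' (Nat.even_mul_succ_self _).two_dvd]
    omega
  rw [← sumSeries_evenSets, sumSeries, coeff_mk, Nat.cast_eq_zero,
    Set.ncard_eq_zero (finite_pos_sum_eq _)] at h0
  exact (h0 ▸ ⟨⟨rfl, hS⟩, rfl⟩ : S ∈ (∅ : Set (Finset ℕ)))

/-- With `K = P.1.card / 2`, the positive sum is at least `2K(2K + 1)` and the negative sum at most
`2K ^ 2 + K`, so `n ≥ 2K ^ 2 + K ≥ K`. -/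
lemma card_div_two_le_of_mem_signedPairs {n : ℕ} {P : Finset ℕ × Finset ℕ}
    (hP : P ∈ signedPairs n) : P.1.card / 2 ≤ n := by
  obtain ⟨h1, h2, h3⟩ := hP
  have h4 := card_mul_le_sum h1
  have h5 : P.2.sum id ≤ (negParts (P.1.card / 2)).sum id :=
    Finset.sum_le_sum_of_subset h2
  rw [sum_negParts] at h5
  have h6 : 2 * (P.1.card / 2) ≤ P.1.card := Nat.mul_div_le _ _
  nlinarith

lemma finite_signedPairs (n : ℕ) : (signedPairs n).Finite := by
  refine ((Finset.range (n + (negParts n).sum id + 1)).powerset ×ˢ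
    (negParts n).powerset).finite_toSet.subset fun P hP ↦ ?_
  have hQ : P.2 ⊆ negParts n :=
    hP.2.1.trans (negParts_mono (card_div_two_le_of_mem_signedPairs hP))
  have hs : P.2.sum id ≤ (negParts n).sum id := Finset.sum_le_sum_of_subset hQ
  simp only [Finset.coe_product, Set.mem_prod, Finset.mem_coe, Finset.mem_powerset]
  refine ⟨fun x hx ↦ ?_, hQ⟩
  have h1 : x ≤ P.1.sum id := Finset.single_le_sum (f := id) (fun i _ ↦ Nat.zero_le i) hx
  have h2 := hP.2.2
  rw [Finset.mem_range]
  omega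

/-- Multiplying by `X` to the sum of all allowed negative parts avoids negative exponents: a chosen
set `T` of negative parts is then weighted by its complement in `negParts (k / 2)`. -/
lemma ncard_signedPairs_card (n k : ℕ) :
    ({P ∈ signedPairs n | P.1.card = k}.ncard : ℚ) =
      coeff (n + (negParts (k / 2)).sum id)
        (evenSeries k * ∏ b ∈ negParts (k / 2), (1 + X ^ b)) := by
  have hfin : {P ∈ signedPairs n | P.1.card = k}.Finite :=
    (finite_signedPairs n).subset fun P hP ↦ hP.1
  rw [ncard_eq_sum_ncard_fiber hfin Prod.snd (negParts (k / 2)).powerset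
    (fun P hP ↦ Finset.mem_powerset.2 (hP.2 ▸ hP.1.2.1)),
    Finset.prod_add, Finset.mul_sum, map_sum, Nat.cast_sum]
  refine Finset.sum_congr rfl fun T hT ↦ ?_
  rw [Finset.mem_powerset] at hT
  rw [Finset.prod_const_one, one_mul, Finset.prod_pow_eq_pow_sum, mul_comm]
  have hsum := Finset.sum_sdiff (f := id) hT
  simp only [id] at hsum ⊢
  rw [← hsum, show n + (∑ x ∈ negParts (k / 2) \ T, x + ∑ x ∈ T, x) =
    (n + ∑ x ∈ T, x) + ∑ x ∈ negParts (k / 2) \ T, x by ring, coeff_X_pow_mul,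
    ← sumSeries_evenSets, sumSeries, coeff_mk]
  congr 1
  rw [← Set.ncard_image_of_injective {S ∈ evenSets k | S.sum id = n + ∑ x ∈ T, x}
    (Prod.mk_left_injective T)]
  refine congrArg Set.ncard (Set.ext fun ⟨S, U⟩ ↦ ?_)
  constructor
  · rintro ⟨⟨⟨h1, h2, h3⟩, h4⟩, rfl⟩
    exact ⟨S, ⟨⟨h4, h1⟩, h3⟩, rfl⟩
  · rintro ⟨S', ⟨⟨h4, h1⟩, h3⟩, h⟩
    obtain ⟨rfl, rfl⟩ := Prod.mk.inj h
    exact ⟨⟨⟨h1, h4 ▸ hT, h3⟩, h4⟩, rfl⟩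

lemma sum_range_two_mul {M : Type*} [AddCommMonoid M] (f : ℕ → M) (N : ℕ) :
    ∑ k ∈ Finset.range (2 * N), f k = ∑ K ∈ Finset.range N, (f (2 * K) + f (2 * K + 1)) := by
  induction N with
  | zero => rfl
  | succ N ih =>
    rw [Finset.sum_range_succ, ← ih, show 2 * (N + 1) = 2 * N + 1 + 1 by ring,
      Finset.sum_range_succ, Finset.sum_range_succ, add_assoc]

lemma ncard_signedPairs (n : ℕ) :
    ((signedPairs n).ncard : ℚ) = coeff n (signedSum (n + 1) X) := by
  rw [ncard_eq_sum_ncard_fiber (finite_signedPairs n) (fun P ↦ P.1.card)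
    (Finset.range (2 * (n + 1))) (fun P hP ↦ by
      have := card_div_two_le_of_mem_signedPairs hP
      rw [Finset.mem_range]
      omega), Nat.cast_sum, sum_range_two_mul, signedSum, map_sum]
  refine Finset.sum_congr rfl fun K _ ↦ ?_
  rw [ncard_signedPairs_card, ncard_signedPairs_card, show 2 * K / 2 = K by omega,
    show (2 * K + 1) / 2 = K by omega, ← map_add, ← add_mul, evenSeries_add_evenSeries,
    sum_negParts, ← coeff_X_pow_mul _ (2 * K ^ 2 + K) n]
  congr 1
  -- One `X` from each factor turns `X ^ (4b + 3)` into `X ^ (4(b + 1))`; these account for the `X ^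
  -- K` in `X ^ (2 * K ^ 2 + K) = (X ^ 2) ^ (K ^ 2) * X ^ K`.
  have h : ∏ b ∈ Finset.range K, (X + (X ^ 2 : ℚ⟦X⟧) ^ (2 * (b + 1))) =
      X ^ K * ∏ b ∈ negParts K, (1 + X ^ b) := by
    simp only [negParts, Finset.prod_map, fourMulAddThree_apply]
    rw [← Finset.card_range K, ← Finset.prod_const, Finset.card_range, ← Finset.prod_mul_distrib]
    refine Finset.prod_congr rfl fun b _ ↦ ?_
    ring
  rw [h]
  ring

lemma ncard_gollnitz (n : ℕ) :
    ({S : Finset ℕ | S ∈ gollnitzSets S.card ∧ S.sum id = n}.ncard : ℚ) =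
      coeff n (gollnitzSum (2 * (n + 1)) X) := by
  have hfin : {S : Finset ℕ | S ∈ gollnitzSets S.card ∧ S.sum id = n}.Finite :=
    finite_pos_sum_eq (s := {S | S ∈ gollnitzSets S.card}) n
  rw [ncard_eq_sum_ncard_fiber hfin Finset.card (Finset.range (2 * (n + 1))) ?_, gollnitzSum,
    map_sum, Nat.cast_sum]
  · refine Finset.sum_congr rfl fun k _ ↦ ?_
    rw [← sumSeries_gollnitzSets, sumSeries, coeff_mk]
    congr 2
    ext S
    constructor
    · rintro ⟨⟨h1, h2⟩, rfl⟩
      exact ⟨h1, h2⟩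
    · rintro ⟨h1, h2⟩
      obtain rfl := h1.1
      exact ⟨⟨h1, h2⟩, rfl⟩
  · rintro S ⟨h1, h2⟩
    have h3 : S.card * 2 ≤ S.sum id := by
      rw [← smul_eq_mul]
      exact Finset.card_nsmul_le_sum _ _ _ h1.2.1
    rw [Finset.mem_range]
    omega

lemma ncard_gollnitz_eq_ncard_signedPairs (n : ℕ) :
    {S : Finset ℕ | S ∈ gollnitzSets S.card ∧ S.sum id = n}.ncard = (signedPairs n).ncard := by
  have h := X_pow_dvd_iff.1 (X_pow_dvd_signedSum_sub_gollnitzSum (n + 1) X) n (Nat.lt_succ_self n)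
  rw [map_sub, ← ncard_signedPairs, ← ncard_gollnitz, sub_eq_zero] at h
  exact_mod_cast h.symm

/-! ### From finite sets back to partitions -/

/-- The partition whose parts are the elements of a finite set of positive integers. -/
def partitionOfFinset (S : Finset ℕ) (h : ∀ x ∈ S, 0 < x) : (S.sum id).Partition where
  parts := S.val
  parts_pos := fun hx ↦ h _ hx
  parts_sum := by rw [Finset.sum, Multiset.map_id]

lemma sum_toFinset_of_nodup {m : Multiset ℕ} (h : m.Nodup) : m.toFinset.sum id = m.sum := by
  rw [Finset.sum, Multiset.toFinset_val, h.dedup, Multiset.map_id]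

lemma card_toFinset_of_nodup {m : Multiset ℕ} (h : m.Nodup) : m.toFinset.card = m.card :=
  Multiset.toFinset_card_of_nodup h

lemma toFinset_inj_of_nodup {m m' : Multiset ℕ} (h : m.Nodup) (h' : m'.Nodup)
    (e : m.toFinset = m'.toFinset) : m = m' := by
  have := congrArg Finset.val e
  rwa [Multiset.toFinset_val, Multiset.toFinset_val, h.dedup, h'.dedup] at this

lemma SignedPartition.ext_parts {n : ℤ} {σ τ : SignedPartition n}
    (hp : σ.pos.parts = τ.pos.parts) (hn : σ.neg.parts = τ.neg.parts) : σ = τ := by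
  obtain ⟨a, b, p, q, h⟩ := σ
  obtain ⟨a', b', p', q', h'⟩ := τ
  simp only at hp hn
  obtain rfl : a = a' := by rw [← p.parts_sum, hp, p'.parts_sum]
  obtain rfl : b = b' := by rw [← q.parts_sum, hn, q'.parts_sum]
  obtain rfl := Nat.Partition.ext hp
  obtain rfl := Nat.Partition.ext hn
  rfl

/-- The sets of positive and of negative parts of a signed partition. -/
def SignedPartition.partSets {n : ℤ} (σ : SignedPartition n) : Finset ℕ × Finset ℕ :=
  (σ.pos.parts.toFinset, σ.neg.parts.toFinset)

lemma injOn_partSets (n : ℤ) : Set.InjOn SignedPartition.partSets (signedH n) := by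
  rintro σ ⟨h1, -, h2, -⟩ τ ⟨h3, -, h4, -⟩ h
  obtain ⟨e1, e2⟩ := Prod.mk.inj h
  exact SignedPartition.ext_parts (toFinset_inj_of_nodup h1 h3 e1) (toFinset_inj_of_nodup h2 h4 e2)

lemma image_partSets (n : ℕ) : SignedPartition.partSets '' signedH (n : ℤ) = signedPairs n := by
  ext ⟨S, T⟩
  constructor
  · rintro ⟨σ, ⟨h1, h2, h3, h4⟩, h⟩
    obtain ⟨rfl, rfl⟩ := Prod.mk.inj h
    refine ⟨fun x hx ↦ ?_, fun y hy ↦ ?_, ?_⟩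
    · rw [Multiset.mem_toFinset] at hx
      exact ⟨σ.pos.parts_pos hx, h2 x hx⟩
    · rw [Multiset.mem_toFinset] at hy
      rw [card_toFinset_of_nodup h1, mem_negParts]
      exact h4 y hy
    · rw [sum_toFinset_of_nodup h1, sum_toFinset_of_nodup h3, σ.pos.parts_sum, σ.neg.parts_sum]
      have := σ.size_eq
      omega
  · rintro ⟨h1, h2, h3⟩
    have hT : ∀ y ∈ T, y ≡ 3 [MOD 4] ∧ y < 2 * S.card := fun y hy ↦ mem_negParts.1 (h2 hy)
    have hTpos : ∀ y ∈ T, 0 < y := by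
      intro y hy
      have := (hT y hy).1
      rw [Nat.ModEq] at this
      omega
    refine ⟨⟨_, _, partitionOfFinset S fun x hx ↦ (h1 x hx).1, partitionOfFinset T hTpos, ?_⟩,
      ⟨S.nodup, fun x hx ↦ (h1 x hx).2, T.nodup, hT⟩, ?_⟩
    · simp only at h3
      omega
    · simp [SignedPartition.partSets, partitionOfFinset]

lemma LG₂_eq_ncard (n : ℕ) :
    LG₂ n = {S : Finset ℕ | S ∈ gollnitzSets S.card ∧ S.sum id = n}.ncard := by
  have hinj : Set.InjOn (fun p : n.Partition ↦ p.parts.toFinset) (secondLittleGollnitz n) :=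
    fun p hp q hq h ↦ Nat.Partition.ext (toFinset_inj_of_nodup hp.1 hq.1 h)
  rw [LG₂, ← hinj.ncard_image]
  congr 1
  ext S
  constructor
  · rintro ⟨p, ⟨h1, h2, h3, h4⟩, rfl⟩
    refine ⟨⟨rfl, ?_⟩, ?_⟩
    · simp only [Multiset.mem_toFinset]
      exact ⟨h2, h3, h4⟩
    · simp only
      rw [sum_toFinset_of_nodup h1, p.parts_sum]
  · rintro ⟨⟨-, h2, h3, h4⟩, rfl⟩
    exact ⟨partitionOfFinset S fun x hx ↦ two_pos.trans_le (h2 x hx),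
      ⟨S.nodup, h2, h3, h4⟩, by simp [partitionOfFinset]⟩

theorem mainTheorem10 (n : ℕ) :
    (signedH (n : ℤ)).Finite ∧ LG₂ n = (signedH (n : ℤ)).ncard := by
  refine ⟨Set.Finite.of_finite_image ?_ (injOn_partSets n), ?_⟩
  · rw [image_partSets]
    exact finite_signedPairs n
  · rw [LG₂_eq_ncard, ncard_gollnitz_eq_ncard_signedPairs, ← image_partSets,
      (injOn_partSets n).ncard_image]
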